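/- A Steiner loop is a set with a commutative binary operation and an identity element $e$ such that $x\cdot(x\cdot y)=y$ and $x\cdot x=e$ for all $x,y$ (such a structure is automatically a loop). Let $X$ be a finite set with $|X|>3$, and let $S(X)$ be the free Steiner loop with set of free generators $X$. Then the group $\mathrm{Aut}(S(X))$ of all automorphisms of the loop $S(X)$ is not finitely generated. -/

import Mathlib

/-- A Steiner loop: a commutative loop with `x * (x * y) = y` and `x * x = 1`.
Unique solvability of `a * y = b` and `y * a = b` follows from these laws and is proved below. -/
class SteinerLoop (L : Type*) extends MulOneClass L where
  mul_comm : ∀ x y : L, x * y = y * x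
  mul_mul_cancel : ∀ x y : L, x * (x * y) = y
  mul_self : ∀ x : L, x * x = 1

namespace SteinerLoop

/-- The equations defining a loop are uniquely solvable in a Steiner loop. -/
theorem existsUnique_mul_eq {L : Type*} [SteinerLoop L] (a b : L) :
    (∃! y : L, a * y = b) ∧ ∃! y : L, y * a = b := by
  have h : ∃! y : L, a * y = b :=
    ⟨a * b, mul_mul_cancel a b, fun y hy => by rw [← hy, mul_mul_cancel]⟩
  refine ⟨h, ?_⟩
  simpa only [fun y : L => mul_comm y a] using h

end SteinerLoop

/-- Loop terms in the letters `X`: formal products of letters and the identity symbol. -/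
inductive SteinerTerm (X : Type*) where
  | of (x : X) : SteinerTerm X
  | one : SteinerTerm X
  | mul (u v : SteinerTerm X) : SteinerTerm X

namespace SteinerTerm

instance (X : Type*) : Mul (SteinerTerm X) := ⟨SteinerTerm.mul⟩

instance (X : Type*) : One (SteinerTerm X) := ⟨SteinerTerm.one⟩

/-- The instances of the defining identities of Steiner loops. -/
inductive Law (X : Type*) : SteinerTerm X → SteinerTerm X → Prop
  | one_mul (u : SteinerTerm X) : Law X (1 * u) u
  | mul_one (u : SteinerTerm X) : Law X (u * 1) u
  | mul_comm (u v : SteinerTerm X) : Law X (u * v) (v * u)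
  | mul_mul_cancel (u v : SteinerTerm X) : Law X (u * (u * v)) v
  | mul_self (u : SteinerTerm X) : Law X (u * u) 1

/-- The value of a term in a Steiner loop under an assignment of the letters. -/
def eval {X L : Type*} [SteinerLoop L] (f : X → L) : SteinerTerm X → L
  | of x => f x
  | one => 1
  | mul u v => eval f u * eval f v

end SteinerTerm

/-- The free Steiner loop `S(X)` on the set `X`: terms modulo the smallest congruence that contains
all instances of the identities of Steiner loops. -/
def FreeSteinerLoop (X : Type*) : Type _ := (conGen (SteinerTerm.Law X)).Quotient

namespace FreeSteinerLoop

/-- The class of a term. -/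
def mk {X : Type*} (u : SteinerTerm X) : FreeSteinerLoop X :=
  (u : (conGen (SteinerTerm.Law X)).Quotient)

/-- The free generators. -/
def of {X : Type*} (x : X) : FreeSteinerLoop X := mk (SteinerTerm.of x)

theorem mk_surjective {X : Type*} : Function.Surjective (mk : SteinerTerm X → _) :=
  Quotient.mk_surjective

theorem mk_eq_of_law {X : Type*} {u v : SteinerTerm X} (h : SteinerTerm.Law X u v) :
    mk u = mk v :=
  (Con.eq (conGen (SteinerTerm.Law X))).2 (ConGen.Rel.of u v h)

instance (X : Type*) : Mul (FreeSteinerLoop X) :=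
  inferInstanceAs (Mul (conGen (SteinerTerm.Law X)).Quotient)

instance (X : Type*) : One (FreeSteinerLoop X) := ⟨mk 1⟩

theorem mk_mul {X : Type*} (u v : SteinerTerm X) : mk (u * v) = mk u * mk v := rfl

instance (X : Type*) : SteinerLoop (FreeSteinerLoop X) where
  one_mul a := by
    obtain ⟨u, rfl⟩ := mk_surjective a
    exact mk_eq_of_law (.one_mul u)
  mul_one a := by
    obtain ⟨u, rfl⟩ := mk_surjective a
    exact mk_eq_of_law (.mul_one u)
  mul_comm a b := by
    obtain ⟨u, rfl⟩ := mk_surjective a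
    obtain ⟨v, rfl⟩ := mk_surjective b
    exact mk_eq_of_law (.mul_comm u v)
  mul_mul_cancel a b := by
    obtain ⟨u, rfl⟩ := mk_surjective a
    obtain ⟨v, rfl⟩ := mk_surjective b
    exact mk_eq_of_law (.mul_mul_cancel u v)
  mul_self a := by
    obtain ⟨u, rfl⟩ := mk_surjective a
    exact mk_eq_of_law (.mul_self u)

theorem eval_eq_of_conGen {X L : Type*} [SteinerLoop L] (f : X → L) {u v : SteinerTerm X}
    (h : conGen (SteinerTerm.Law X) u v) : u.eval f = v.eval f := by
  have h' : ConGen.Rel (SteinerTerm.Law X) u v := h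
  clear h
  induction h' with
  | of u v h =>
    cases h with
    | one_mul => exact one_mul _
    | mul_one => exact mul_one _
    | mul_comm => exact SteinerLoop.mul_comm _ _
    | mul_mul_cancel => exact SteinerLoop.mul_mul_cancel _ _
    | mul_self => exact SteinerLoop.mul_self _
  | refl => rfl
  | symm _ ih => exact ih.symm
  | trans _ _ ih₁ ih₂ => exact ih₁.trans ih₂
  | mul _ _ ih₁ ih₂ => exact congrArg₂ (· * ·) ih₁ ih₂

/-- The homomorphism extending a map on the free generators. -/
def lift {X L : Type*} [SteinerLoop L] (f : X → L) : FreeSteinerLoop X →* L where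
  toFun := Quotient.lift (SteinerTerm.eval f) fun _ _ h => eval_eq_of_conGen f h
  map_one' := rfl
  map_mul' a b := by
    obtain ⟨u, rfl⟩ := mk_surjective a
    obtain ⟨v, rfl⟩ := mk_surjective b
    rfl

/-- The universal property: every map from `X` to a Steiner loop extends uniquely to a homomorphism
of loops on `FreeSteinerLoop X`. -/
theorem existsUnique_hom {X L : Type*} [SteinerLoop L] (f : X → L) :
    ∃! g : FreeSteinerLoop X →* L, ∀ x, g (of x) = f x := by
  refine ⟨lift f, fun _ => rfl, fun g hg => MonoidHom.ext fun a => ?_⟩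
  obtain ⟨u, rfl⟩ := mk_surjective a
  induction u with
  | of x => exact hg x
  | one => exact map_one g
  | mul u v ihu ihv =>
    exact (map_mul g (mk u) (mk v)).trans (congrArg₂ (· * ·) ihu ihv)

end FreeSteinerLoop

/-! Automorphisms carry a divergence that confines a finitely generated group to finitely many
orbits of pairs. Extending `S(X)` by vectors over the square-zero ring `Coeff` gives Fox derivatives
with a chain rule (`fox_map`). The Jacobian determinant of an automorphism is `1` plus a linear
part, and this linear part is a crossed homomorphism into finitely supported functions on pairs of
elements (`divergence_mul`). Hence finitely many generators force all divergences to be supported on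
finitely many `Aut`-orbits of pairs (`support_divergence_subset_of_closure`).

For `w` not involving `x`, the automorphism `x ↦ x * w` has `(x, w)` in the support of its
divergence. Let `w` run over the words `(L_a L_b) ^ (2 ^ m) z * z` in three other letters. They lie
in distinct orbits: iterated central extensions by `ZMod 2` give Steiner loops in which the later
words vanish identically but the `m`-th does not (`exists_translation₂_exponent`). -/

namespace SteinerLoop

/-! ### Central extensions and the exponent of products of two translations -/

/-- A symmetric `ZMod 2`-valued cocycle on a Steiner loop: a function that is constant on the
triples `{q, r, q * r}` and vanishes on the degenerate ones. -/
structure Cocycle (Q : Type*) [SteinerLoop Q] where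
  toFun : Q → Q → ZMod 2
  symm : ∀ q r, toFun q r = toFun r q
  one_left : ∀ q, toFun 1 q = 0
  self : ∀ q, toFun q q = 0
  mul_right : ∀ q r, toFun q (q * r) = toFun q r

/-- The underlying set of the central extension of a Steiner loop by `ZMod 2`. -/
@[ext]
structure Cocycle.Extension {Q : Type*} [SteinerLoop Q] (c : Cocycle Q) where
  base : Q
  fiber : ZMod 2

namespace Cocycle

variable {Q : Type*} [SteinerLoop Q] (c : Cocycle Q)

instance : Mul c.Extension := ⟨fun p q => ⟨p.base * q.base, p.fiber + q.fiber + c.toFun p.base q.base⟩⟩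

instance : One c.Extension := ⟨⟨1, 0⟩⟩

@[simp] theorem base_mul (p q : c.Extension) : (p * q).base = p.base * q.base := rfl

@[simp] theorem fiber_mul (p q : c.Extension) :
    (p * q).fiber = p.fiber + q.fiber + c.toFun p.base q.base := rfl

@[simp] theorem base_one : (1 : c.Extension).base = 1 := rfl

@[simp] theorem fiber_one : (1 : c.Extension).fiber = 0 := rfl

instance : SteinerLoop c.Extension where
  one_mul p := by ext <;> simp [c.one_left]
  mul_one p := by ext <;> simp [c.symm _ 1, c.one_left]
  mul_comm p q := by
    ext
    · simp [SteinerLoop.mul_comm]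
    · simp [c.symm p.base, add_comm p.fiber]
  mul_mul_cancel p q := by
    ext
    · simp [SteinerLoop.mul_mul_cancel]
    · simp only [fiber_mul, base_mul, c.mul_right]
      linear_combination (p.fiber + c.toFun p.base q.base) * CharTwo.two_eq_zero (R := ZMod 2)
  mul_self p := by
    ext
    · simp [SteinerLoop.mul_self]
    · simp [c.self, CharTwo.add_self_eq_zero]

end Cocycle

theorem mul_left_cancel {Q : Type*} [SteinerLoop Q] {a b c : Q} (h : a * b = a * c) : b = c := by
  rw [← mul_mul_cancel a b, h, mul_mul_cancel]

theorem mul_mul_cancel_right {Q : Type*} [SteinerLoop Q] (a b : Q) : b * a * a = b := by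
  rw [mul_comm (b * a), mul_comm b, mul_mul_cancel]

/-- The product of the translations by `a` and by `b`. -/
def translation₂ {Q : Type*} [SteinerLoop Q] (a b q : Q) : Q := a * (b * q)

theorem iterate_translation₂_map {Q R F : Type*} [SteinerLoop Q] [SteinerLoop R] [FunLike F Q R]
    [MonoidHomClass F Q R] (f : F) (a b q : Q) (n : ℕ) :
    f ((translation₂ a b)^[n] q) = (translation₂ (f a) (f b))^[n] (f q) := by
  induction n generalizing q with
  | zero => rfl
  | succ n ih => simp [ih, translation₂]

section LineCocycle

variable {Q : Type*} [SteinerLoop Q]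

open Classical in
/-- The cocycle which is `1` on the triple through `b` and `z` and `0` on all others. -/
noncomputable def lineCocycle (b z : Q) (hb : b ≠ 1) (hz : z ≠ 1) (hbz : b ≠ z) : Cocycle Q where
  toFun q r := if q ≠ r ∧ (q = b ∨ q = z ∨ q = b * z) ∧ (r = b ∨ r = z ∨ r = b * z) then 1 else 0
  symm q r := by
    congr 1
    exact propext ⟨fun h => ⟨h.1.symm, h.2.2, h.2.1⟩, fun h => ⟨h.1.symm, h.2.2, h.2.1⟩⟩
  one_left q := by
    rw [if_neg]
    rintro ⟨-, h | h | h, -⟩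
    · exact hb h.symm
    · exact hz h.symm
    · apply hbz
      apply mul_left_cancel (a := b)
      rw [mul_self, h]
  self q := by simp
  mul_right q r := by
    have key : ∀ q r : Q, (q ≠ r ∧ (q = b ∨ q = z ∨ q = b * z) ∧ (r = b ∨ r = z ∨ r = b * z)) →
        (q ≠ q * r ∧ (q = b ∨ q = z ∨ q = b * z) ∧ (q * r = b ∨ q * r = z ∨ q * r = b * z)) := by
      rintro q r ⟨hqr, hq, hr⟩
      refine ⟨fun h => ?_, hq, ?_⟩
      · have h1 : r = 1 := mul_left_cancel (a := q) (by rw [← h, mul_one])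
        rw [h1] at hr
        rcases hr with h | h | h
        · exact hb h.symm
        · exact hz h.symm
        · exact hbz (mul_left_cancel (a := b) (by rw [mul_self, h]))
      · have e1 : b * (b * z) = z := mul_mul_cancel b z
        have e2 : z * b = b * z := mul_comm z b
        have e3 : z * (b * z) = b := by rw [← e2, mul_mul_cancel]
        have e4 : b * z * b = z := by rw [mul_comm, e1]
        have e5 : b * z * z = b := by rw [mul_comm, e3]
        rcases hq with rfl | rfl | rfl <;> rcases hr with rfl | rfl | rfl <;> simp_all
    congr 1
    -- Translation by `q` is an involution, so `key` applied to `q * r` gives the converse.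
    refine propext ⟨fun h => ?_, key q r⟩
    have := key _ _ h
    rwa [mul_mul_cancel] at this

theorem lineCocycle_apply_left (b z : Q) (hb : b ≠ 1) (hz : z ≠ 1) (hbz : b ≠ z) :
    (lineCocycle b z hb hz hbz).toFun b z = 1 := by
  simp [lineCocycle, hbz]

theorem lineCocycle_of_left_ne (b z : Q) (hb : b ≠ 1) (hz : z ≠ 1) (hbz : b ≠ z) {q : Q} (r : Q)
    (h1 : q ≠ b) (h2 : q ≠ z) (h3 : q ≠ b * z) : (lineCocycle b z hb hz hbz).toFun q r = 0 := by
  simp [lineCocycle, h1, h2, h3]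

theorem lineCocycle_of_right_ne (b z : Q) (hb : b ≠ 1) (hz : z ≠ 1) (hbz : b ≠ z) {r : Q}
    (h2 : r ≠ z) (h3 : r ≠ b * z) : (lineCocycle b z hb hz hbz).toFun b r = 0 := by
  refine if_neg ?_
  rintro ⟨h, -, h' | h' | h'⟩
  exacts [h h'.symm, h2 h', h3 h']

end LineCocycle

namespace Cocycle

variable {Q : Type*} [SteinerLoop Q] (c : Cocycle Q)

theorem base_iterate_translation₂ (u v p : c.Extension) (n : ℕ) :
    ((translation₂ u v)^[n] p).base = (translation₂ u.base v.base)^[n] p.base := by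
  induction n generalizing p with
  | zero => rfl
  | succ n ih => simp [ih, translation₂]

theorem fiber_translation₂ (u v p : c.Extension) :
    (translation₂ u v p).fiber = u.fiber + v.fiber + p.fiber +
      (c.toFun v.base p.base + c.toFun u.base (v.base * p.base)) := by
  simp only [translation₂, fiber_mul, base_mul]
  ring

theorem fiber_iterate_translation₂ (u v p : c.Extension) (n : ℕ) :
    ((translation₂ u v)^[n] p).fiber = p.fiber + ∑ i ∈ Finset.range n, (u.fiber + v.fiber +
      (c.toFun v.base ((translation₂ u.base v.base)^[i] p.base) +
        c.toFun u.base (v.base * (translation₂ u.base v.base)^[i] p.base))) := by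
  induction n with
  | zero => simp
  | succ n ih =>
    rw [Function.iterate_succ_apply', fiber_translation₂, ih, base_iterate_translation₂,
      Finset.sum_range_succ]
    ring

/-- When the base returns, the fiber has gained a constant depending only on the base orbit; the
second pass adds it again, and it cancels mod 2. -/
theorem iterate_translation₂_two_mul (u v p : c.Extension) (n : ℕ)
    (h : (translation₂ u.base v.base)^[n] p.base = p.base) :
    (translation₂ u v)^[2 * n] p = p := by
  rw [two_mul, Function.iterate_add_apply]
  ext
  · rw [base_iterate_translation₂, base_iterate_translation₂, h, h]
  · rw [fiber_iterate_translation₂, base_iterate_translation₂, h, fiber_iterate_translation₂,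
      add_assoc, CharTwo.add_self_eq_zero, add_zero]

end Cocycle

/-- There are Steiner loops in which the products of two translations have exponent exactly
`2 ^ (m + 1)`. -/
theorem exists_translation₂_exponent (m : ℕ) : ∃ (Q : Type) (_ : SteinerLoop Q) (a b z : Q),
    (∀ u v q : Q, (translation₂ u v)^[2 ^ (m + 1)] q = q) ∧
    (translation₂ a b)^[2 ^ m] z ≠ z ∧ (∀ i, (translation₂ a b)^[i] z ≠ b * z) ∧
    b ≠ 1 ∧ z ≠ 1 ∧ b ≠ z ∧ a ≠ b ∧ a ≠ z ∧ a ≠ b * z := by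
  induction m with
  | zero =>
    -- In the elementary abelian group of order 8, `translation₂ a b` is translation by `a * b`, of
    -- order 2, and the orbit of `z` misses `b * z`.
    let Q := Multiplicative (ZMod 2 × ZMod 2 × ZMod 2)
    let _ : SteinerLoop Q :=
      { (inferInstance : MulOneClass Q) with
        mul_comm := fun x y => CommMonoid.mul_comm x y
        mul_mul_cancel := by decide
        mul_self := by decide }
    have h2 : ∀ u v q : Q, translation₂ u v (translation₂ u v q) = q := by decide
    refine ⟨Q, inferInstance, .ofAdd (1, 0, 0), .ofAdd (0, 1, 0), .ofAdd (0, 0, 1), h2,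
      by decide, fun i => ?_, by decide, by decide, by decide, by decide, by decide, by decide⟩
    have hp : Function.IsPeriodicPt (translation₂ (Multiplicative.ofAdd (1, 0, 0) : Q)
      (.ofAdd (0, 1, 0))) 2 (.ofAdd (0, 0, 1)) := h2 _ _ _
    rw [← hp.iterate_mod_apply]
    have : i % 2 < 2 := Nat.mod_lt _ two_pos
    interval_cases i % 2 <;> decide
  | succ m ih =>
    obtain ⟨Q, _, a, b, z, hexp, hm, horb, hb, hz, hbz, hab, haz, habz⟩ := ih
    let c := lineCocycle b z hb hz hbz
    have hbase : ∀ {q r : Q}, q ≠ r → (⟨q, 0⟩ : c.Extension) ≠ ⟨r, 0⟩ :=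
      fun h h' => h (congrArg Cocycle.Extension.base h')
    refine ⟨c.Extension, inferInstance, ⟨a, 0⟩, ⟨b, 0⟩, ⟨z, 0⟩, fun u v q => ?_, fun h => ?_,
      fun i h => ?_, hbase hb, hbase hz, hbase hbz, hbase hab, hbase haz,
      fun h => habz (congrArg Cocycle.Extension.base h)⟩
    · rw [pow_succ', c.iterate_translation₂_two_mul _ _ _ _ (hexp _ _ _)]
    · have hper : Function.minimalPeriod (translation₂ a b) z = 2 ^ (m + 1) :=
        have := Fact.mk Nat.prime_two
        Function.minimalPeriod_eq_prime_pow hm (hexp a b z)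
      have hf := congrArg Cocycle.Extension.fiber h
      -- Over one full period the orbit of `z` meets the triple `{b, z, b * z}` in a way that `c`
      -- sees only at `i = 0`, and `a` lies off that triple. The fiber therefore changes by `1`,
      -- which doubles the period.
      rw [c.fiber_iterate_translation₂, Finset.sum_eq_single 0] at hf
      · simp [c, lineCocycle_apply_left, lineCocycle_of_left_ne b z hb hz hbz _ hab haz habz] at hf
      · intro i hi hi0
        rw [lineCocycle_of_left_ne b z hb hz hbz _ hab haz habz,
          lineCocycle_of_right_ne b z hb hz hbz _ (horb i)]
        · simp
        · intro hzi
          have hdvd := Function.IsPeriodicPt.minimalPeriod_dvd (n := i) hzi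
          rw [hper] at hdvd
          exact absurd (Nat.le_of_dvd (Nat.pos_of_ne_zero hi0) hdvd)
            (not_le.2 (Finset.mem_range.1 hi))
      · simp
    · apply horb i
      simpa [c.base_iterate_translation₂] using congrArg Cocycle.Extension.base h

end SteinerLoop

/-! ### Translation words and their orbits under automorphisms -/

namespace FreeSteinerLoop

open SteinerLoop

@[elab_as_elim]
theorem induction_on {X : Type*} {p : FreeSteinerLoop X → Prop} (s : FreeSteinerLoop X)
    (of : ∀ x, p (of x)) (one : p 1) (mul : ∀ s t, p s → p t → p (s * t)) : p s := by
  obtain ⟨u, rfl⟩ := mk_surjective s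
  induction u with
  | of x => exact of x
  | one => exact one
  | mul u v hu hv => exact mul _ _ hu hv

@[simp] theorem lift_of {X L : Type*} [SteinerLoop L] (f : X → L) (x : X) : lift f (of x) = f x :=
  rfl

/-- The element `(L_a L_b) ^ (2 ^ m) z * z`. -/
def translationWord {Q : Type*} [SteinerLoop Q] (m : ℕ) (a b z : Q) : Q :=
  (translation₂ a b)^[2 ^ m] z * z

theorem translationWord_map {Q R F : Type*} [SteinerLoop Q] [SteinerLoop R] [FunLike F Q R]
    [MonoidHomClass F Q R] (f : F) (m : ℕ) (a b z : Q) :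
    f (translationWord m a b z) = translationWord m (f a) (f b) (f z) := by
  rw [translationWord, map_mul, iterate_translation₂_map, translationWord]

section Words

variable {X : Type*} {a b z : X}

/-- A homomorphism to a Steiner loop that kills all the `m'`-th translation words with `m < m'` but
not the `m`-th one on the given letters. -/
theorem exists_hom_translationWord_ne_one (hab : a ≠ b) (haz : a ≠ z) (hbz : b ≠ z) (m : ℕ) :
    ∃ (Q : Type) (_ : SteinerLoop Q), (∀ u v q : Q, ∀ m', m < m' → translationWord m' u v q = 1) ∧
      ∃ f : FreeSteinerLoop X →* Q, f (translationWord m (of a) (of b) (of z)) ≠ 1 := by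
  classical
  obtain ⟨Q, _, a', b', z', hexp, hm, -⟩ := exists_translation₂_exponent m
  refine ⟨Q, inferInstance, fun u v q m' hm' => ?_,
    lift (fun x => if x = a then a' else if x = b then b' else z'), fun h => hm ?_⟩
  · obtain ⟨k, hk⟩ := pow_dvd_pow 2 (Nat.succ_le_of_lt hm')
    have : Function.IsPeriodicPt (translation₂ u v) (2 ^ m') q := by
      rw [hk]
      exact Function.IsPeriodicPt.mul_const (hexp u v q) k
    rw [translationWord, this.eq, SteinerLoop.mul_self]
  · rw [translationWord_map] at h
    simp only [lift_of, if_true, if_neg hab.symm, if_neg haz.symm, if_neg hbz.symm,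
      translationWord] at h
    apply SteinerLoop.mul_left_cancel (a := z')
    rw [SteinerLoop.mul_comm, h, SteinerLoop.mul_self]

theorem translationWord_ne_one (hab : a ≠ b) (haz : a ≠ z) (hbz : b ≠ z) (m : ℕ) :
    translationWord m (of a) (of b) (of z) ≠ (1 : FreeSteinerLoop X) := by
  obtain ⟨Q, _, -, f, hf⟩ := exists_hom_translationWord_ne_one hab haz hbz m
  exact fun h => hf (by rw [h, map_one])

/-- In the test loop for `k` the `m`-th word is an identity, so it dies whatever elements `g`
substitutes for its letters, whereas the `k`-th word survives. -/
theorem mulAut_translationWord_ne (hab : a ≠ b) (haz : a ≠ z) (hbz : b ≠ z) {k m : ℕ} (hkm : k < m)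
    (g : MulAut (FreeSteinerLoop X)) :
    g (translationWord m (of a) (of b) (of z)) ≠ translationWord k (of a) (of b) (of z) := by
  obtain ⟨Q, _, hQ, f, hf⟩ := exists_hom_translationWord_ne_one hab haz hbz k
  intro h
  apply hf
  rw [← h, translationWord_map, translationWord_map, hQ _ _ _ _ hkm]

end Words

theorem of_ne_one {X : Type*} (x : X) : (of x : FreeSteinerLoop X) ≠ 1 := by
  obtain ⟨Q, _, a, b, z, -, -, -, hb, -⟩ := exists_translation₂_exponent 0
  intro h
  apply hb
  rw [← lift_of (fun _ : X => b) x, h, map_one]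

end FreeSteinerLoop

/-! ### Transport coefficients and the Fox extension -/

namespace SteinerLoop

/-- The trivial square-zero extension of `ZMod 2` by the vector space on the pairs of elements
of `S`. -/
abbrev Coeff (S : Type*) := TrivSqZeroExt (ZMod 2) (S × S →₀ ZMod 2)

theorem Coeff.add_self {S : Type*} (r : Coeff S) : r + r = 0 := by
  ext
  · simp [CharTwo.add_self_eq_zero]
  · simp [CharTwo.add_self_eq_zero]

/-- The ring homomorphism induced by a map of the underlying sets. -/
noncomputable def Coeff.map {S T : Type*} (f : S → T) : Coeff S →ₐ[ZMod 2] Coeff T :=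
  TrivSqZeroExt.map (Finsupp.lmapDomain (ZMod 2) (ZMod 2) (Prod.map f f))

variable {S : Type*} [SteinerLoop S]

/-- The weight of the passage from `t` to `s * t` inside the triple `{s, t, s * t}`. -/
noncomputable def weight (s t : S) : S × S →₀ ZMod 2 :=
  .single (s * t, s) 1 + .single (s * t, t) 1 + .single (t, s) 1 + .single (t, s * t) 1

theorem finsupp_add_self {S : Type*} (v : S × S →₀ ZMod 2) : v + v = 0 := by
  ext
  simp [CharTwo.add_self_eq_zero]

theorem weight_mul_right (s t : S) : weight s (s * t) = weight s t := by
  simp only [weight, mul_mul_cancel]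
  abel

theorem weight_one_left (t : S) : weight 1 t = 0 := by
  simp only [weight, one_mul]
  rw [add_assoc, finsupp_add_self]

/-- Give each point `p` of the triple the potential `(p, q) + (p, r)`, with `q`, `r` the other two
points. A weight is the sum of the potentials at the two ends of a passage, so the three weights
around the triple cancel mod 2. -/
theorem weight_triangle (s t : S) : weight (s * t) s = weight s t + weight t s := by
  have h1 : s * t * s = t := by rw [mul_comm, mul_mul_cancel]
  simp only [weight, h1, mul_comm t s]
  have e (a b c d e f : S × S →₀ ZMod 2) : a + b + c + d = e + f + b + a + (f + e + d + c) := by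
    have := finsupp_add_self e
    have := finsupp_add_self f
    calc a + b + c + d = a + b + c + d + (e + e) + (f + f) := by simp [*]
      _ = _ := by abel
  exact e _ _ _ _ _ _

/-- The unit of `Coeff S` by which passing from `t` to `s * t` multiplies. -/
noncomputable def transport (s t : S) : Coeff S := 1 + TrivSqZeroExt.inr (weight s t)

theorem transport_one_left (t : S) : transport 1 t = 1 := by
  rw [transport, weight_one_left, TrivSqZeroExt.inr_zero, add_zero]

theorem transport_mul_right (s t : S) : transport s (s * t) = transport s t := by
  rw [transport, weight_mul_right, transport]

theorem transport_mul_self (s t : S) : transport s t * transport s t = 1 := by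
  ext
  · simp [transport]
  · simp [transport, finsupp_add_self]

theorem transport_triangle (s t : S) :
    transport (s * t) s = transport s t * transport t s := by
  rw [transport, weight_triangle]
  ext
  · simp [transport]
  · simp [transport, add_comm]

theorem map_transport {T F : Type*} [SteinerLoop T] [FunLike F S T] [MonoidHomClass F S T] (f : F)
    (s t : S) : Coeff.map f (transport s t) = transport (f s) (f t) := by
  ext
  · simp [Coeff.map, transport]
  · simp [Coeff.map, transport, weight]

/-- The underlying set of the extension of `S` by `X → Coeff S` with the action by transports. -/
@[ext]
structure FoxExtension (X S : Type*) where
  base : S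
  coord : X → Coeff S

namespace FoxExtension

variable {X : Type*}

noncomputable instance : Mul (FoxExtension X S) :=
  ⟨fun p q => ⟨p.base * q.base,
    transport q.base p.base • p.coord + transport p.base q.base • q.coord⟩⟩

noncomputable instance : One (FoxExtension X S) := ⟨⟨1, 0⟩⟩

@[simp] theorem base_mul (p q : FoxExtension X S) : (p * q).base = p.base * q.base := rfl

@[simp] theorem coord_mul (p q : FoxExtension X S) : (p * q).coord =
    transport q.base p.base • p.coord + transport p.base q.base • q.coord := rfl

@[simp] theorem base_one : (1 : FoxExtension X S).base = 1 := rfl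

@[simp] theorem coord_one : (1 : FoxExtension X S).coord = 0 := rfl

theorem coord_add_self {X S : Type*} (v : X → Coeff S) : v + v = 0 := funext fun _ => Coeff.add_self _

noncomputable instance : SteinerLoop (FoxExtension X S) where
  one_mul p := by ext1 <;> simp [transport_one_left]
  mul_one p := by ext1 <;> simp [transport_one_left]
  mul_comm p q := by
    ext1
    · simp [SteinerLoop.mul_comm]
    · simp [add_comm]
  mul_mul_cancel p q := by
    ext1
    · simp [SteinerLoop.mul_mul_cancel]
    -- The triangle identity makes the two coefficients of `p.coord` equal, so they cancel; that of
    -- `q.coord` is a square, hence `1`.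
    · simp only [coord_mul, base_mul, transport_mul_right, transport_triangle, smul_add, smul_smul,
        transport_mul_self, one_smul]
      rw [← add_assoc, coord_add_self, zero_add]
  mul_self p := by
    ext1
    · simp [SteinerLoop.mul_self]
    · simp [coord_add_self]

end FoxExtension

end SteinerLoop

/-! ### Fox derivatives, Jacobians and divergence -/

namespace FreeSteinerLoop

open SteinerLoop

variable {X : Type*}

open Classical in
/-- The homomorphism to the extension whose second component is the vector of Fox derivatives. -/
noncomputable def foxHom : FreeSteinerLoop X →* FoxExtension X (FreeSteinerLoop X) :=
  lift fun x => ⟨of x, Pi.single x 1⟩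

/-- The vector of Fox derivatives of an element of the free Steiner loop. -/
noncomputable def fox (s : FreeSteinerLoop X) : X → Coeff (FreeSteinerLoop X) := (foxHom s).coord

theorem base_foxHom (s : FreeSteinerLoop X) : (foxHom s).base = s := by
  induction s using induction_on with
  | of x => rfl
  | one => simp
  | mul s t hs ht => simp [hs, ht]

theorem fox_of [DecidableEq X] (x : X) : fox (of x) = Pi.single x 1 := by
  simp only [fox, foxHom, lift_of]
  congr!

theorem fox_one : fox (1 : FreeSteinerLoop X) = 0 := by simp [fox]

theorem fox_mul (s t : FreeSteinerLoop X) :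
    fox (s * t) = transport t s • fox s + transport s t • fox t := by
  simp [fox, base_foxHom]

theorem fox_mul_apply_eq_zero {x : X} {s t : FreeSteinerLoop X} (hs : fox s x = 0)
    (ht : fox t x = 0) : fox (s * t) x = 0 := by
  simp [fox_mul, hs, ht]

theorem fox_translationWord_apply_eq_zero {x : X} {a b z : FreeSteinerLoop X} (ha : fox a x = 0)
    (hb : fox b x = 0) (hz : fox z x = 0) (m : ℕ) : fox (translationWord m a b z) x = 0 := by
  refine fox_mul_apply_eq_zero ?_ hz
  generalize 2 ^ m = n
  induction n with
  | zero => exact hz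
  | succ n ih =>
    rw [Function.iterate_succ_apply']
    exact fox_mul_apply_eq_zero ha (fox_mul_apply_eq_zero hb ih)

section Jacobian

variable [Fintype X]

/-- The chain rule, which holds because transports are natural under homomorphisms
(`map_transport`). -/
theorem fox_map (f : FreeSteinerLoop X →* FreeSteinerLoop X) (s : FreeSteinerLoop X) :
    fox (f s) = ∑ x, Coeff.map f (fox s x) • fox (f (of x)) := by
  classical
  induction s using induction_on with
  | of x =>
    rw [Finset.sum_eq_single x]
    · simp [fox_of]
    · intro y _ hy
      simp [fox_of, hy]
    · simp
  | one => simp [fox_one]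
  | mul s t hs ht =>
    rw [map_mul, fox_mul, hs, ht, fox_mul, Finset.smul_sum, Finset.smul_sum,
      ← Finset.sum_add_distrib]
    refine Finset.sum_congr rfl fun x _ => ?_
    simp only [Pi.add_apply, Pi.smul_apply, smul_eq_mul, map_add, map_mul, map_transport, add_smul,
      mul_smul]

/-- The Jacobian matrix of an endomorphism. -/
noncomputable def jacobian (f : FreeSteinerLoop X →* FreeSteinerLoop X) :
    Matrix X X (Coeff (FreeSteinerLoop X)) := .of fun x => fox (f (of x))

theorem jacobian_comp (f g : FreeSteinerLoop X →* FreeSteinerLoop X) :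
    jacobian (f.comp g) = (jacobian g).map (Coeff.map f) * jacobian f := by
  ext1 x y
  simp [jacobian, Matrix.mul_apply, fox_map f (g (of x))]

theorem jacobian_id {X : Type*} [DecidableEq X] : jacobian (MonoidHom.id (FreeSteinerLoop X)) = 1 := by
  ext1 x y
  simp [jacobian, fox_of, Matrix.one_apply, Pi.single_apply, eq_comm]

variable [DecidableEq X]

theorem det_jacobian_comp (f g : FreeSteinerLoop X →* FreeSteinerLoop X) :
    (jacobian (f.comp g)).det = Coeff.map f (jacobian g).det * (jacobian f).det := by
  rw [jacobian_comp, Matrix.det_mul, AlgHom.map_det]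
  rfl

/-- The determinant of the Jacobian matrix of an automorphism. -/
noncomputable def jacobianDet (f : MulAut (FreeSteinerLoop X)) : Coeff (FreeSteinerLoop X) :=
  (jacobian f.toMonoidHom).det

theorem jacobianDet_one : jacobianDet (1 : MulAut (FreeSteinerLoop X)) = 1 := by
  exact (congrArg Matrix.det jacobian_id).trans Matrix.det_one

theorem jacobianDet_mul (f g : MulAut (FreeSteinerLoop X)) :
    jacobianDet (f * g) = Coeff.map f (jacobianDet g) * jacobianDet f :=
  det_jacobian_comp f.toMonoidHom g.toMonoidHom

/-- The determinant is invertible, and `1` is the only unit of `ZMod 2`. -/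
theorem fst_jacobianDet (f : MulAut (FreeSteinerLoop X)) : (jacobianDet f).fst = 1 := by
  have h := congrArg TrivSqZeroExt.fst (jacobianDet_mul f⁻¹ f)
  rw [inv_mul_cancel, jacobianDet_one, TrivSqZeroExt.fst_mul, TrivSqZeroExt.fst_one, Coeff.map,
    TrivSqZeroExt.fst_map] at h
  revert h
  generalize (jacobianDet f).fst = r
  generalize (jacobianDet f⁻¹).fst = s
  revert r s
  decide

/-- The linear part of the determinant of the Jacobian matrix. -/
noncomputable def divergence (f : MulAut (FreeSteinerLoop X)) :
    FreeSteinerLoop X × FreeSteinerLoop X →₀ ZMod 2 := (jacobianDet f).snd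

theorem divergence_one : divergence (1 : MulAut (FreeSteinerLoop X)) = 0 := by
  rw [divergence, jacobianDet_one, TrivSqZeroExt.snd_one]

/-- Both determinants have constant term `1` and the ideal squares to zero, so multiplying them adds
their linear parts. -/
theorem divergence_mul (f g : MulAut (FreeSteinerLoop X)) :
    divergence (f * g) = divergence f + (divergence g).mapDomain (Prod.map f f) := by
  simp [divergence, jacobianDet_mul, fst_jacobianDet, Coeff.map]

theorem divergence_inv (f : MulAut (FreeSteinerLoop X)) :
    divergence f⁻¹ = (divergence f).mapDomain (Prod.map ⇑f⁻¹ ⇑f⁻¹) := by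
  have h := divergence_mul f⁻¹ f
  rw [inv_mul_cancel, divergence_one] at h
  exact (eq_neg_of_add_eq_zero_left h.symm).trans (neg_eq_of_add_eq_zero_left (finsupp_add_self _))

/-- The divergences of the elements of a subgroup are supported on any invariant set of pairs that
contains the supports of the divergences of generators. -/
theorem support_divergence_subset_of_closure {A : Set (MulAut (FreeSteinerLoop X))}
    {P : Set (FreeSteinerLoop X × FreeSteinerLoop X)}
    (hP : ∀ g : MulAut (FreeSteinerLoop X), ∀ p ∈ P, Prod.map g g p ∈ P)
    (hA : ∀ f ∈ A, (↑(divergence f).support : Set _) ⊆ P) {f : MulAut (FreeSteinerLoop X)}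
    (hf : f ∈ Subgroup.closure A) : (↑(divergence f).support : Set _) ⊆ P := by
  classical
  have hmap (g : MulAut (FreeSteinerLoop X)) (v : FreeSteinerLoop X × FreeSteinerLoop X →₀ ZMod 2)
      (hv : (↑v.support : Set _) ⊆ P) :
      (↑(v.mapDomain (Prod.map g g)).support : Set _) ⊆ P := by
    intro p hp
    obtain ⟨q, hq, rfl⟩ := Finset.mem_image.1 (Finsupp.mapDomain_support hp)
    exact hP g q (hv hq)
  induction hf using Subgroup.closure_induction with
  | mem f hf => exact hA f hf
  | one => simp [divergence_one]
  | mul f g _ _ hf hg =>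
    rw [divergence_mul]
    intro p hp
    rcases Finset.mem_union.1 (Finsupp.support_add hp) with h | h
    exacts [hf h, hmap f _ hg h]
  | inv f _ hf =>
    rw [divergence_inv]
    exact hmap _ _ hf

end Jacobian

/-! ### Elementary automorphisms -/

section Elementary

variable [DecidableEq X]

/-- The endomorphism `x ↦ x * w` that fixes the other generators. -/
def elementaryHom (x : X) (w : FreeSteinerLoop X) : FreeSteinerLoop X →* FreeSteinerLoop X :=
  lift (Function.update of x (of x * w))

theorem elementaryHom_of_self (x : X) (w : FreeSteinerLoop X) :
    elementaryHom x w (of x) = of x * w := by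
  simp [elementaryHom]

theorem elementaryHom_of_ne {x y : X} (h : y ≠ x) (w : FreeSteinerLoop X) :
    elementaryHom x w (of y) = of y := by
  simp [elementaryHom, h]

theorem elementaryHom_involutive {x : X} {w : FreeSteinerLoop X} (hw : elementaryHom x w w = w) :
    Function.Involutive (elementaryHom x w) := by
  intro s
  induction s using induction_on with
  | of y =>
    obtain rfl | h := eq_or_ne y x
    · rw [elementaryHom_of_self, map_mul, elementaryHom_of_self, hw, mul_mul_cancel_right]
    · rw [elementaryHom_of_ne h, elementaryHom_of_ne h]
  | one => rw [map_one, map_one]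
  | mul s t hs ht => rw [map_mul, map_mul, hs, ht]

/-- The automorphism `x ↦ x * w` that fixes the other generators, for `w` not involving `x`. -/
def elementary (x : X) (w : FreeSteinerLoop X) (hw : elementaryHom x w w = w) :
    MulAut (FreeSteinerLoop X) :=
  { (elementaryHom_involutive hw).toPerm with map_mul' := map_mul (elementaryHom x w) }

theorem divergence_elementary [Fintype X] {x : X} {w : FreeSteinerLoop X}
    (hw : elementaryHom x w w = w) (hx : fox w x = 0) :
    divergence (elementary x w hw) = weight w (of x) := by
  have h : jacobian (elementary x w hw).toMonoidHom =
      (1 : Matrix X X (Coeff (FreeSteinerLoop X))).updateRow x (fox (of x * w)) := by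
    ext1 y z
    obtain rfl | h := eq_or_ne y x
    · simp only [jacobian, Matrix.of_apply, Matrix.updateRow_self]
      exact congrArg (fox · z) (elementaryHom_of_self y w)
    · rw [Matrix.updateRow_ne h, ← jacobian_id]
      exact congrArg (fox · z) (elementaryHom_of_ne h w)
  -- Only row `x` differs from the identity matrix, so the determinant is its diagonal entry,
  -- `transport w (of x)` because `fox w x = 0`.
  rw [divergence, jacobianDet, h, ← Matrix.cramer_transpose_apply, Matrix.transpose_one,
    Matrix.cramer_one]
  simp [fox_mul, hx, fox_of, transport]

theorem mem_support_divergence_elementary [Fintype X] {x : X} {w : FreeSteinerLoop X}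
    (hw : elementaryHom x w w = w) (hx : fox w x = 0) (hw1 : w ≠ 1) :
    (of x, w) ∈ (divergence (elementary x w hw)).support := by
  have h1 : w * of x ≠ of x := fun h => hw1 (SteinerLoop.mul_left_cancel (a := of x) (by
    rw [SteinerLoop.mul_comm, h, mul_one]))
  have h2 : w * of x ≠ w := fun h => of_ne_one x (SteinerLoop.mul_left_cancel (a := w) (by
    rw [h, mul_one]))
  rw [divergence_elementary hw hx, Finsupp.mem_support_iff]
  simp [weight, h1, h2]

end Elementary

end FreeSteinerLoop

/-! ### Infinitely many orbits of pairs -/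

open FreeSteinerLoop in
theorem mainTheorem2 (X : Type*) [Finite X] (hX : 3 < Nat.card X) :
    ¬ Group.FG (MulAut (FreeSteinerLoop X)) := by
  classical
  have := Fintype.ofFinite X
  rw [Nat.card_eq_fintype_card] at hX
  -- Three letters spell the words; the fourth is the generator to be moved.
  obtain ⟨i⟩ : Nonempty (Fin 4 ↪ X) := Function.Embedding.nonempty_of_card_le 
    (by rwa [Fintype.card_fin])
  have hi {j k : Fin 4} (h : j ≠ k) : i j ≠ i k := fun h' => h (i.injective h')
  let w (m : ℕ) : FreeSteinerLoop X := translationWord m (of (i 0)) (of (i 1)) (of (i 2))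
  have hw (m : ℕ) : elementaryHom (i 3) (w m) (w m) = w m := by
    conv_lhs => arg 2; unfold w
    rw [translationWord_map, elementaryHom_of_ne (hi (by decide)),
      elementaryHom_of_ne (hi (by decide)), elementaryHom_of_ne (hi (by decide))]
  have hfox (m : ℕ) : fox (w m) (i 3) = 0 := by
    apply fox_translationWord_apply_eq_zero <;> rw [fox_of, Pi.single_eq_of_ne (hi (by decide))]
  have hw1 (m : ℕ) : w m ≠ 1 :=
    translationWord_ne_one (hi (by decide)) (hi (by decide)) (hi (by decide)) m
  rw [Group.fg_iff]
  rintro ⟨A, hA, hfin⟩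
  let F := ⋃ f ∈ A, (↑(divergence f).support : Set (FreeSteinerLoop X × FreeSteinerLoop X))
  have hF : F.Finite := hfin.biUnion fun f _ => Finset.finite_toSet _
  have key (m : ℕ) : ∃ g : MulAut (FreeSteinerLoop X), Prod.map g g (of (i 3), w m) ∈ F := by
    refine support_divergence_subset_of_closure (A := A)
      -- The union of the orbits that meet the finite set `F`.
      (P := {p | ∃ g : MulAut (FreeSteinerLoop X), Prod.map g g p ∈ F}) ?_ ?_ ?_
      (mem_support_divergence_elementary (hw m) (hfox m) (hw1 m))
    · rintro g p ⟨h, hp⟩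
      refine ⟨h * g⁻¹, ?_⟩
      simpa [Prod.map] using hp
    · intro f hf p hp
      exact ⟨1, Set.mem_biUnion hf hp⟩
    · rw [hA]
      trivial
  choose g hg using key
  have hne {k m : ℕ} (hkm : k < m) : g k (w k) ≠ g m (w m) := by
    intro h
    apply mulAut_translationWord_ne (hi (j := 0) (k := 1) (by decide))
      (hi (j := 0) (k := 2) (by decide)) (hi (j := 1) (k := 2) (by decide)) hkm
      ((g k)⁻¹ * g m)
    change (g k)⁻¹ (g m (w m)) = w k
    rw [← h]
    exact MulAut.inv_apply_self _ (g k) (w k)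
  -- Pigeonhole: two of the pairs are moved to the same point of `F`, which puts two words in one
  -- orbit.
  obtain ⟨k, -, m, -, hkm, h⟩ := Set.infinite_univ.exists_ne_map_eq_of_mapsTo
    (f := fun m => Prod.map (g m) (g m) (of (i 3), w m)) (fun m _ => hg m) hF
  have h' : g k (w k) = g m (w m) := congrArg Prod.snd h
  rcases hkm.lt_or_gt with hlt | hlt
  exacts [hne hlt h', hne hlt h'.symm]
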